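/- Let $h\colon \mathbb{R}^m \to [-\infty,+\infty]$ be lower semicontinuous and convex, and let $\partial h$ denote its convex subdifferential: $v \in \partial h(c)$ if and only if $h(c)$ is finite and $h(y) \ge h(c) + \langle v, y-c\rangle$ for all $y \in \mathbb{R}^m$. Let $\bar c \in \mathbb{R}^m$, let $\bar v$ lie in the relative interior of $\partial h(\bar c)$, and let $\mathcal{M} \subset \mathbb{R}^m$ be a closed set containing $\bar c$. Suppose that $h$ is partly smooth at $\bar c$ relative to $\mathcal{M}$, that is: (a) $\mathcal{M}$ is a $C^2$ manifold around $\bar c$ (near $\bar c$, it is the zero set of a $C^2$ map into some $\mathbb{R}^k$ with surjective derivative at $\bar c$); (b) the restriction $h|_{\mathcal{M}}$ is $C^2$ around $\bar c$ (near $\bar c$, it agrees on $\mathcal M$ with a real-valued $C^2$ function); (c) the set-valued mapping $\partial h$, restricted to $\mathcal{M}$, is continuous at $\bar c$ in the Painlevé–Kuratowski sense, that is, $\limsup_{c \to \bar c,\, c \in \mathcal{M}} \partial h(c) \subset \partial h(\bar c) \subset \liminf_{c \to \bar c,\, c \in \mathcal{M}} \partial h(c)$; (d) the affine span of $\partial h(\bar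 c)$ is a translate of the normal space to $\mathcal{M}$ at $\bar c$ (the orthogonal complement of the tangent space). Then the sets $$G^1 = \{(c,v) : c \in \mathcal{M},\ v \in \partial h(c)\}, \qquad G^2 = \mathrm{cl}\,\{(c,v) : c \notin \mathcal{M},\ v \in \partial h(c)\}$$ are both closed in $\mathbb{R}^m \times \mathbb{R}^m$, the graph $\{(c,v) : v \in \partial h(c)\}$ of $\partial h$ equals $G^1 \cup G^2$, and $(\bar c, \bar v) \notin G^2$. -/

import Mathlib

open Filter Topology

namespace PartialSmoothness

/-- The Euclidean space `ℝᵐ`. -/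
abbrev Vec (m : ℕ) : Type := EuclideanSpace ℝ (Fin m)

/-- An extended-real-valued function (values `-∞` and `+∞` are allowed) is convex when its
epigraph is a convex subset of `ℝᵐ × ℝ`. -/
def IsConvexFun {m : ℕ} (h : Vec m → EReal) : Prop :=
  Convex ℝ {p : Vec m × ℝ | h p.1 ≤ (p.2 : EReal)}

/-- The classical convex subdifferential: `v ∈ ∂h(c)` when `h(c)` is finite and
`h(y) ≥ h(c) + ⟨v, y - c⟩` for all `y`. It is empty at points where `h` is not finite. -/
def subdiff {m : ℕ} (h : Vec m → EReal) (c : Vec m) : Set (Vec m) :=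
  {v | h c ≠ ⊤ ∧ h c ≠ ⊥ ∧ ∀ y : Vec m, h c + ((inner ℝ v (y - c) : ℝ) : EReal) ≤ h y}

/-- The graph `{(c, v) : v ∈ ∂h(c)}` of the subdifferential mapping. -/
def gphSubdiff {m : ℕ} (h : Vec m → EReal) : Set (Vec m × Vec m) :=
  {p | p.2 ∈ subdiff h p.1}

/-- `M` is a (`C²`, embedded) manifold around its point `c`: near `c` it is the zero set of a `C²`
map into some `ℝᵏ` whose derivative at `c` is surjective. -/
def IsManifoldAround {m : ℕ} (M : Set (Vec m)) (c : Vec m) : Prop :=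
  c ∈ M ∧ ∃ (k : ℕ) (F : Vec m → Vec k), ContDiffAt ℝ 2 F c ∧
    Function.Surjective (fderiv ℝ F c) ∧ ∀ᶠ x in 𝓝 c, (x ∈ M ↔ F x = 0)

/-- The tangent vectors to `M` at `c`: velocities at time `0` of `C¹` curves in `M` passing
through `c` at time `0`. -/
def tangentVectors {m : ℕ} (M : Set (Vec m)) (c : Vec m) : Set (Vec m) :=
  {u | ∃ γ : ℝ → Vec m, ContDiffAt ℝ 1 γ 0 ∧ γ 0 = c ∧ HasDerivAt γ u 0 ∧ ∀ᶠ t in 𝓝 0, γ t ∈ M}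

/-- The normal space to `M` at `c`: the orthogonal complement of the tangent space. (Where `M` is a
manifold, the tangent vectors already form a subspace and the span changes nothing.) -/
noncomputable def normalSpace {m : ℕ} (M : Set (Vec m)) (c : Vec m) : Submodule ℝ (Vec m) :=
  (Submodule.span ℝ (tangentVectors M c))ᗮ

/-- The restriction of `h` to `M` is `C²` around `c`: near `c`, it agrees on `M` with a real-valued
function that is `C²` around `c`. -/
def IsC2RestrictedAround {m : ℕ} (h : Vec m → EReal) (M : Set (Vec m)) (c : Vec m) : Prop :=
  ∃ g : Vec m → ℝ, ContDiffAt ℝ 2 g c ∧ ∀ᶠ x in 𝓝[M] c, h x = (g x : EReal)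

/-- Outer limit `limsup S(x)` of a set-valued map as `x → c` within `M` (Painlevé–Kuratowski). -/
def outerLimit {m : ℕ} (S : Vec m → Set (Vec m)) (M : Set (Vec m)) (c : Vec m) : Set (Vec m) :=
  {u | ∀ W ∈ 𝓝 u, ∃ᶠ x in 𝓝[M] c, (S x ∩ W).Nonempty}

/-- Inner limit `liminf S(x)` of a set-valued map as `x → c` within `M` (Painlevé–Kuratowski). -/
def innerLimit {m : ℕ} (S : Vec m → Set (Vec m)) (M : Set (Vec m)) (c : Vec m) : Set (Vec m) :=
  {u | ∀ W ∈ 𝓝 u, ∀ᶠ x in 𝓝[M] c, (S x ∩ W).Nonempty}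

/-- A set-valued map, restricted to `M`, is continuous at `c` when it is both outer and inner
semicontinuous there. -/
def SetContinuousWithinAt {m : ℕ} (S : Vec m → Set (Vec m)) (M : Set (Vec m)) (c : Vec m) : Prop :=
  outerLimit S M c ⊆ S c ∧ S c ⊆ innerLimit S M c

/-- Partial smoothness at `c` relative to `M`, for a lower semicontinuous convex function `h`. -/
structure IsPartlySmoothAt {m : ℕ} (h : Vec m → EReal) (c : Vec m) (M : Set (Vec m)) : Prop where
  manifold : IsManifoldAround M c
  smooth : IsC2RestrictedAround h M c
  continuous : SetContinuousWithinAt (subdiff h) M c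
  /-- The affine span of `∂h(c)` is a translate of the normal space. -/
  span_eq : ∃ a : Vec m, affineSpan ℝ (subdiff h c) = AffineSubspace.mk' a (normalSpace M c)

/-- The part of the graph of `∂h` lying over `M`. -/
def graphOver {m : ℕ} (h : Vec m → EReal) (M : Set (Vec m)) : Set (Vec m × Vec m) :=
  {p | p.1 ∈ M ∧ p.2 ∈ subdiff h p.1}

/-- The closure of the part of the graph of `∂h` lying off `M`. -/
def closureGraphOff {m : ℕ} (h : Vec m → EReal) (M : Set (Vec m)) : Set (Vec m × Vec m) :=
  closure {p | p.1 ∉ M ∧ p.2 ∈ subdiff h p.1}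

end PartialSmoothness

namespace PartialSmoothness

/-! Lower semicontinuity makes the graph of `∂h` closed; as `M` is closed too, everything but the
last claim is formal. For that claim, suppose `(cₙ, vₙ) → (cbar, vbar)` in the graph with `cₙ ∉ M`,
and let `xₙ` be a nearest point of `M` to `cₙ`. The unit residuals `(cₙ - xₙ)/‖cₙ - xₙ‖` subconverge
to a unit normal `d` at `cbar`. Normal directions are those of the affine span of `∂h(cbar)`, so
`vbar + ε • d ∈ ∂h(cbar)` for some `ε > 0`. Inner semicontinuity along `M` gives subgradients `wₙ`
at `xₙ` near `vbar + ε • d`. Monotonicity forces `⟨vₙ - wₙ, cₙ - xₙ⟩ ≥ 0`, but after normalization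
this is close to `-ε`. -/

/-- The convex subdifferential is a monotone operator. -/
theorem inner_sub_nonneg_of_mem_subdiff {m : ℕ} {h : Vec m → EReal} {c x v w : Vec m}
    (hv : v ∈ subdiff h c) (hw : w ∈ subdiff h x) : 0 ≤ inner ℝ (v - w) (c - x) := by
  obtain ⟨hc₁, hc₂, hc⟩ := hv
  obtain ⟨hx₁, hx₂, hx⟩ := hw
  have h₁ := hc x
  have h₂ := hx c
  lift h c to ℝ using ⟨hc₁, hc₂⟩ with a
  lift h x to ℝ using ⟨hx₁, hx₂⟩ with b
  norm_cast at h₁ h₂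
  have h₃ : inner ℝ v (x - c) = -inner ℝ v (c - x) := by
    rw [← inner_neg_right, neg_sub]
  rw [inner_sub_left]
  linarith

/-- The subdifferential of a lower semicontinuous function that is somewhere subdifferentiable has
closed graph. -/
theorem isClosed_gphSubdiff {m : ℕ} {h : Vec m → EReal} (hlsc : LowerSemicontinuous h)
    {c₀ v₀ : Vec m} (h₀ : v₀ ∈ subdiff h c₀) : IsClosed (gphSubdiff h) := by
  -- The finiteness conditions come for free: testing at `c₀` excludes `⊤`, and the affine minorant
  -- given by `v₀` excludes `⊥`.
  have key : gphSubdiff h = ⋂ y : Vec m,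
      {p : Vec m × Vec m | h p.1 + ((inner ℝ p.2 (y - p.1) : ℝ) : EReal) ≤ h y} := by
    ext ⟨c, v⟩
    simp only [gphSubdiff, subdiff, Set.mem_ofPred_eq, Set.mem_iInter]
    refine ⟨fun H => H.2.2, fun H => ⟨fun htop => ?_, fun hbot => ?_, H⟩⟩
    · have := H c₀
      rw [htop, EReal.top_add_coe] at this
      exact h₀.1 (top_le_iff.1 this)
    · have := h₀.2.2 c
      have h₁ := h₀.1
      have h₂ := h₀.2.1
      rw [hbot] at this
      lift h c₀ to ℝ using ⟨h₁, h₂⟩ with a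
      rw [← EReal.coe_add, le_bot_iff] at this
      exact EReal.coe_ne_bot _ this
  rw [key]
  refine isClosed_iInter fun y => ?_
  have hl : LowerSemicontinuous fun p : Vec m × Vec m =>
      h p.1 + ((inner ℝ p.2 (y - p.1) : ℝ) : EReal) := by
    refine LowerSemicontinuous.add' (hlsc.comp continuous_fst) ?_ fun p => ?_
    · exact (continuous_coe_real_ereal.comp (by fun_prop)).lowerSemicontinuous
    · exact EReal.continuousAt_add (Or.inr (EReal.coe_ne_bot _)) (Or.inr (EReal.coe_ne_top _))
  exact hl.isClosed_preimage (h y)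

/-- Tangent vectors to a zero set lie in the kernel of the derivative. -/
theorem fderiv_apply_eq_zero_of_mem_tangentVectors {m k : ℕ} {M : Set (Vec m)} {c u : Vec m}
    {F : Vec m → Vec k} (hF : DifferentiableAt ℝ F c) (hMF : ∀ᶠ x in 𝓝 c, (x ∈ M ↔ F x = 0))
    (hu : u ∈ tangentVectors M c) : fderiv ℝ F c u = 0 := by
  obtain ⟨γ, -, hγ₀, hγ, hγM⟩ := hu
  subst hγ₀
  have h₁ : HasDerivAt (F ∘ γ) (fderiv ℝ F (γ 0) u) 0 :=
    hF.hasFDerivAt.comp_hasDerivAt 0 hγ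
  have h₂ : F ∘ γ =ᶠ[𝓝 0] fun _ => 0 := by
    filter_upwards [hγM, hγ.continuousAt.eventually hMF] with t ht ht'
    exact ht'.1 ht
  exact h₁.unique ((hasDerivAt_const (0 : ℝ) (0 : Vec k)).congr_of_eventuallyEq h₂)

/-- If `x` is a nearest point to `c` in a set that is regular at `x`, the residual `c - x` is
orthogonal to the kernel of the derivative of the defining map. -/
theorem inner_sub_eq_zero_of_isNearest {m k : ℕ} {M : Set (Vec m)} {c x w : Vec m}
    {F : Vec m → Vec k} {A : Vec m →L[ℝ] Vec k} (hF : HasStrictFDerivAt F A x)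
    (hA : Function.Surjective A) (hMF : ∀ᶠ y in 𝓝 x, (y ∈ M ↔ F y = 0)) (hx : x ∈ M)
    (hmin : ∀ y ∈ M, dist c x ≤ dist c y) (hw : A w = 0) : inner ℝ (c - x) w = 0 := by
  have hFx : F x = 0 := hMF.self_of_nhds.1 hx
  have hφ : HasStrictFDerivAt (fun y : Vec m => ‖y - c‖ ^ 2)
      ((2 : ℝ) • (innerSL ℝ (x - c))) x := by
    have h₁ := (hasStrictFDerivAt_norm_sq (x - c)).comp x
      ((hasStrictFDerivAt_id (𝕜 := ℝ) x).sub_const c)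
    refine h₁.congr_fderiv ?_
    ext y
    simp
  have hloc : IsLocalExtrOn (fun y : Vec m => ‖y - c‖ ^ 2) {y | F y = F x} x := by
    left
    filter_upwards [mem_nhdsWithin_of_mem_nhds hMF, self_mem_nhdsWithin] with y hy hy'
    have hyM : y ∈ M := hy.2 (by rw [← hFx]; exact hy')
    have := hmin y hyM
    rw [dist_comm c x, dist_comm c y, dist_eq_norm, dist_eq_norm] at this
    gcongr
  obtain ⟨Λ, Λ₀, hne, hΛ⟩ := hloc.exists_linear_map_of_hasStrictFDerivAt hF hφ
  -- The Lagrange multiplier rule is nondegenerate: if `Λ₀ = 0`, then `Λ` vanishes on the range of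
  -- `A`, which is everything.
  have hΛ₀ : Λ₀ ≠ 0 := by
    rintro rfl
    refine hne (Prod.ext (LinearMap.ext fun z => ?_) rfl)
    obtain ⟨y, rfl⟩ := hA z
    simpa using hΛ y
  have h₁ := hΛ w
  rw [hw, map_zero, zero_add] at h₁
  have h₂ : inner ℝ (x - c) w = 0 := by simpa [hΛ₀, inner_sub_left] using h₁
  rw [← neg_sub x c, inner_neg_left, h₂, neg_zero]

/-- Kernel vectors of a surjective derivative extend continuously to kernel vectors of nearby
derivatives, which are again surjective. -/
theorem exists_tendsto_ker_of_surjective {m k : ℕ} {A : Vec m → (Vec m →L[ℝ] Vec k)} {c u : Vec m}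
    (hA : ContinuousAt A c) (hs : Function.Surjective (A c)) (hu : A c u = 0) :
    ∃ U : Vec m → Vec m, Tendsto U (𝓝 c) (𝓝 u) ∧
      ∀ᶠ x in 𝓝 c, Function.Surjective (A x) ∧ A x (U x) = 0 := by
  obtain ⟨R₀, hR₀⟩ := (A c : Vec m →ₗ[ℝ] Vec k).exists_rightInverse_of_surjective
    (LinearMap.range_eq_top.2 hs)
  let R : Vec k →L[ℝ] Vec m := LinearMap.toContinuousLinearMap R₀
  let B : Vec m → (Vec k →L[ℝ] Vec k) := fun x => (A x).comp R
  have hB : ContinuousAt B c := hA.clm_comp continuousAt_const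
  have hBc : B c = 1 := by
    ext1 z
    exact LinearMap.congr_fun hR₀ z
  have hunit : ∀ᶠ x in 𝓝 c, IsUnit (B x) :=
    hB.eventually (Units.isOpen.mem_nhds (by rw [hBc]; exact isUnit_one))
  have hinv : ContinuousAt (fun x => Ring.inverse (B x)) c := by
    have h₁ : ContinuousAt Ring.inverse (B c) := by
      rw [hBc]
      exact NormedRing.inverse_continuousAt (1 : (Vec k →L[ℝ] Vec k)ˣ)
    exact ContinuousAt.comp (f := B) h₁ hB
  -- Near `c`, `R ∘ (B x)⁻¹` is a right inverse of `A x`; it removes the part of `u` outside the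
  -- kernel, a correction that tends to zero because `A c u = 0`.
  refine ⟨fun x => u - R (Ring.inverse (B x) (A x u)), ?_, ?_⟩
  · have h₁ : ContinuousAt (fun x => u - R (Ring.inverse (B x) (A x u))) c :=
      continuousAt_const.sub
        (R.continuous.continuousAt.comp (hinv.clm_apply (hA.clm_apply continuousAt_const)))
    simpa [ContinuousAt, hu] using h₁
  · filter_upwards [hunit] with x hx
    have h₁ : ∀ z, A x (R (Ring.inverse (B x) z)) = z := fun z =>
      DFunLike.congr_fun (Ring.mul_inverse_cancel (B x) hx) z
    exact ⟨fun z => ⟨_, h₁ z⟩, by rw [map_sub, h₁, sub_self]⟩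

/-- Limits of unit vectors pointing from nearest points in a manifold to the projected points are
normal to the manifold. -/
theorem mem_normalSpace_of_tendsto_residual {m : ℕ} {M : Set (Vec m)} {cbar d : Vec m}
    (hM : IsManifoldAround M cbar) {c x : ℕ → Vec m} (hx : ∀ n, x n ∈ M)
    (hmin : ∀ n, ∀ y ∈ M, dist (c n) (x n) ≤ dist (c n) y) (hxc : Tendsto x atTop (𝓝 cbar))
    (hd : Tendsto (fun n => ‖c n - x n‖⁻¹ • (c n - x n)) atTop (𝓝 d)) :
    d ∈ normalSpace M cbar := by
  obtain ⟨-, k, F, hF, hs, hMF⟩ := hM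
  have hF' : ContinuousAt (fderiv ℝ F) cbar :=
    (hF.fderiv_right (m := 1) (by norm_num)).continuousAt
  have hstrict : ∀ᶠ y in 𝓝 cbar, HasStrictFDerivAt F (fderiv ℝ F y) y := by
    filter_upwards [hF.eventually (by simp)] with y hy
    exact hy.hasStrictFDerivAt (by norm_num)
  rw [normalSpace, Submodule.mem_orthogonal]
  intro u hu
  induction hu using Submodule.span_induction with
  | zero => simp
  | add y z _ _ hy hz => rw [inner_add_left, hy, hz, add_zero]
  | smul a y _ hy => rw [inner_smul_left, hy, mul_zero]
  | mem u hu =>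
    have hker := fderiv_apply_eq_zero_of_mem_tangentVectors
      (hF.differentiableAt (by norm_num)) hMF hu
    obtain ⟨U, hU, hUx⟩ := exists_tendsto_ker_of_surjective hF' hs hker
    have hlim := (hU.comp hxc).inner (𝕜 := ℝ) hd
    refine tendsto_nhds_unique_of_eventuallyEq hlim tendsto_const_nhds ?_
    filter_upwards [hxc.eventually hUx, hxc.eventually hstrict,
      hxc.eventually hMF.eventually_nhds] with n h₁ h₂ h₃
    have := inner_sub_eq_zero_of_isNearest h₂ h₁.1 h₃ (hx n) (hmin n) h₁.2
    rw [Function.comp_apply, inner_smul_right, real_inner_comm, this, mul_zero]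

/-- From a relative interior point one can move a little in any direction of the affine span. -/
theorem exists_pos_add_smul_mem_of_mem_intrinsicInterior {m : ℕ} {S : Set (Vec m)} {v d : Vec m}
    (hv : v ∈ intrinsicInterior ℝ S) (hd : d ∈ (affineSpan ℝ S).direction) :
    ∃ ε > (0 : ℝ), v + ε • d ∈ S := by
  obtain ⟨v', hv', rfl⟩ := mem_intrinsicInterior.1 hv
  -- The line is taken inside the affine span, where the relative interior is an ordinary interior.
  let f : ℝ → affineSpan ℝ S := fun t => ⟨t • d + v',
    AffineSubspace.vadd_mem_of_mem_direction (Submodule.smul_mem _ t hd) v'.2⟩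
  have hf : Continuous f := by fun_prop
  have hf₀ : f 0 = v' := Subtype.ext (by simp [f])
  have hev : ∀ᶠ t in 𝓝 (0 : ℝ), f t ∈ ((↑) ⁻¹' S : Set (affineSpan ℝ S)) :=
    hf.continuousAt.eventually (by rw [hf₀]; exact mem_interior_iff_mem_nhds.1 hv')
  obtain ⟨ε, hε, hpos⟩ :=
    ((hev.filter_mono nhdsWithin_le_nhds).and (self_mem_nhdsWithin (s := Set.Ioi (0 : ℝ)))).exists
  exact ⟨ε, hpos, by rw [add_comm]; exact hε⟩

/-- Near a relative interior subgradient at a point of partial smoothness, the graph of the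
subdifferential lies over the active manifold. -/
theorem notMem_closureGraphOff {m : ℕ} {h : Vec m → EReal} {cbar vbar : Vec m}
    (hv : vbar ∈ intrinsicInterior ℝ (subdiff h cbar)) {M : Set (Vec m)} (hM : IsClosed M)
    (hps : IsPartlySmoothAt h cbar M) : (cbar, vbar) ∉ closureGraphOff h M := by
  intro hmem
  obtain ⟨p, hp, hlim⟩ := mem_closure_iff_seq_limit.1 hmem
  have hcbar : cbar ∈ M := hps.manifold.1
  have hproj : ∀ n, ∃ x ∈ M, ∀ y ∈ M, dist (p n).1 x ≤ dist (p n).1 y := fun n => by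
    obtain ⟨x, hx, hx'⟩ := hM.exists_infDist_eq_dist ⟨cbar, hcbar⟩ (p n).1
    exact ⟨x, hx, fun y hy => hx' ▸ Metric.infDist_le_dist_of_mem hy⟩
  choose x hx hmin using hproj
  have hc : Tendsto (fun n => (p n).1) atTop (𝓝 cbar) := (continuous_fst.tendsto _).comp hlim
  have hvn : Tendsto (fun n => (p n).2) atTop (𝓝 vbar) := (continuous_snd.tendsto _).comp hlim
  have hxc : Tendsto x atTop (𝓝 cbar) := by
    have h₀ : Tendsto (fun n => dist (p n).1 cbar) atTop (𝓝 0) := tendsto_iff_dist_tendsto_zero.1 hc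
    refine tendsto_iff_dist_tendsto_zero.2 (squeeze_zero (fun _ => dist_nonneg) (fun n => ?_)
      (by simpa using h₀.add h₀))
    calc dist (x n) cbar ≤ dist (x n) (p n).1 + dist (p n).1 cbar := dist_triangle _ _ _
      _ ≤ dist (p n).1 cbar + dist (p n).1 cbar := by
        rw [dist_comm (x n)]
        gcongr
        exact hmin n _ hcbar
  have hne : ∀ n, (p n).1 - x n ≠ 0 := fun n h0 =>
    (hp n).1 (by rw [sub_eq_zero.1 h0]; exact hx n)
  obtain ⟨d, hdmem, φ, hφ, hd⟩ := (isCompact_sphere (0 : Vec m) 1).tendsto_subseq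
    (x := fun n => ‖(p n).1 - x n‖⁻¹ • ((p n).1 - x n)) fun n => by
      simp [norm_smul, inv_mul_cancel₀ (norm_ne_zero_iff.2 (hne n))]
  have hdN : d ∈ normalSpace M cbar :=
    mem_normalSpace_of_tendsto_residual hps.manifold (c := fun n => (p (φ n)).1)
      (fun n => hx (φ n)) (fun n => hmin (φ n)) (hxc.comp hφ.tendsto_atTop) hd
  obtain ⟨a, ha⟩ := hps.span_eq
  obtain ⟨ε, hε, hεd⟩ := exists_pos_add_smul_mem_of_mem_intrinsicInterior hv
    (d := d) (by rw [ha, AffineSubspace.direction_mk']; exact hdN)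
  have hd1 : ‖d‖ = 1 := by simpa using hdmem
  have hcont : Continuous fun q : Vec m × Vec m × Vec m => (inner ℝ (q.1 - q.2.1) q.2.2 : ℝ) := by
    fun_prop
  have hneg : (inner ℝ (vbar - (vbar + ε • d)) d : ℝ) < 0 := by
    rw [sub_add_cancel_left, inner_neg_left, inner_smul_left, real_inner_self_eq_norm_sq, hd1]
    simpa using hε
  -- Negativity is an open condition, so a single index with all three vectors close to their limits
  -- suffices; no sequence of `wₙ` need be chosen.
  have hnear : ∀ᶠ q in 𝓝 vbar ×ˢ (𝓝 (vbar + ε • d) ×ˢ 𝓝 d),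
      (inner ℝ (q.1 - q.2.1) q.2.2 : ℝ) < 0 := by
    rw [← nhds_prod_eq, ← nhds_prod_eq]
    exact hcont.continuousAt.eventually_lt_const hneg
  obtain ⟨P, hP, Q, hQ, hPQ⟩ := eventually_prod_iff.1 hnear
  obtain ⟨W, hW, D, hD, hWD⟩ := eventually_prod_iff.1 hQ
  have hxM : Tendsto x atTop (𝓝[M] cbar) :=
    tendsto_nhdsWithin_iff.2 ⟨hxc, Eventually.of_forall hx⟩
  have hinner := (hxM.comp hφ.tendsto_atTop).eventually (hps.continuous.2 hεd {w | W w} hW)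
  obtain ⟨n, ⟨w, hw, hwW⟩, hPn, hDn⟩ := (hinner.and
    (((hvn.comp hφ.tendsto_atTop).eventually hP).and (hd.eventually hD))).exists
  have hlt := hPQ hPn (hWD hwW hDn)
  have hmono := inner_sub_nonneg_of_mem_subdiff (hp (φ n)).2 hw
  simp only [Function.comp_apply, inner_smul_right] at hlt hmono
  exact hlt.not_ge (mul_nonneg (by positivity) hmono)

end PartialSmoothness

theorem mainTheorem5 {m : ℕ} (h : PartialSmoothness.Vec m → EReal)
    (hlsc : LowerSemicontinuous h) (hconv : PartialSmoothness.IsConvexFun h)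
    (cbar vbar : PartialSmoothness.Vec m)
    (hv : vbar ∈ intrinsicInterior ℝ (PartialSmoothness.subdiff h cbar))
    (M : Set (PartialSmoothness.Vec m)) (hM : IsClosed M)
    (hps : PartialSmoothness.IsPartlySmoothAt h cbar M) :
    IsClosed (PartialSmoothness.graphOver h M) ∧
    IsClosed (PartialSmoothness.closureGraphOff h M) ∧
    PartialSmoothness.gphSubdiff h =
      PartialSmoothness.graphOver h M ∪ PartialSmoothness.closureGraphOff h M ∧
    (cbar, vbar) ∉ PartialSmoothness.closureGraphOff h M := by
  have hgph := PartialSmoothness.isClosed_gphSubdiff hlsc (intrinsicInterior_subset hv)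
  refine ⟨(hM.preimage continuous_fst).inter hgph, isClosed_closure, ?_,
    PartialSmoothness.notMem_closureGraphOff hv hM hps⟩
  refine Set.Subset.antisymm (fun p hp => ?_) (Set.union_subset (fun p hp => hp.2)
    (closure_minimal (fun p hp => hp.2) hgph))
  by_cases hpM : p.1 ∈ M
  · exact Or.inl ⟨hpM, hp⟩
  · exact Or.inr (subset_closure ⟨hpM, hp⟩)
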